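/- **Setting.** For $f\in\mathbb R^n$ put $\|f\|_n^2=\frac1n\sum_{i=1}^n f_i^2$, and let $\|\cdot\|_1$ be the $\ell^1$-norm. Let $\vec G=([n],\{e_1,\dots,e_m\})$ be a directed graph without self-loops whose underlying undirected graph (no two edges joining the same pair of vertices) is a tree, or is a cycle through all $n\ge 3$ vertices. Let $D\in\{-1,0,1\}^{m\times n}$ be its incidence matrix: row $i$ has entry $-1$ at the source of $e_i$, $+1$ at the target of $e_i$, and $0$ elsewhere. Let $f^0\in\mathbb R^n$ and $\sigma\in(0,\infty)$, and let $Y=f^0+\epsilon$ with $\epsilon\sim\mathcal N_n(0,\sigma^2 I_n)$. For $\lambda_0>0$ the square root analysis estimator $\hat f$ is a minimizer over $f\in\mathbb R^n$ of $$\|Y-f\|_n+\lambda_0\|Df\|_1 .$$ Let $S\subseteq[m]$ be an admissible active set, i.e. $S=\{j\in[m]:(Dg)_j\neq0\}$ for some $g\in\mathbb R^n$; if $\vec G$ is a cycle, assume $S\ne\emptyset$. Let $D_{-S}$ consist of the rows of $D$ with index not in $S$, let $r_S=\dim\ker D_{-S}$, and let $n_{\max}$ be the largest number of vertices of a connected component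 of the graph obtained from $\vec G$ by deleting the edges $e_i$, $i\in S$. **Assumption.** Let $a>0$ and $\eta\in(0,1)$ satisfy $n>8a$ and $$\eta>2\,\frac{\sqrt{r_S}+\sqrt{2a}}{\sqrt{n-\sqrt{8an}}},$$ and let $$\|Df^0\|_1\le \frac{c\,\sigma}{\lambda_0}\sqrt{1-\sqrt{8a/n}},\qquad c=\sqrt{\Big(\frac{\eta}{2}-\frac{\sqrt{r_S}+\sqrt{2a}}{\sqrt{n-\sqrt{8an}}}\Big)^2+4}\;-2 ,$$ where $\lambda_0\ge R/(1-\eta)$ for some $R>0$. **Statement.** Let $t\in\big(0,\ \tfrac{n-1}{2}-\log(2(n-r_S))\big)$ and $$\lambda_0\ \ge\ \frac1{1-\eta}\sqrt{n_{\max}\,\frac{\log(2n)+t}{n(n-1)}} .$$ Then, for every $f\in\mathbb R^n$, with probability at least $1-e^{-t}-4e^{-a}$, every minimizer $\hat f$ satisfies $$\|\hat f-f^0\|_n^2\ \le\ \|f-f^0\|_n^2+\frac{\sigma^2}{n}\big(\sqrt{2a}+\sqrt{r_S}\big)^2+16\,\sigma\,\lambda_0\,\|Df\|_1 .$$ In particular,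 when $\lambda_0$ equals its lower bound, the last term is $$\frac{16\sigma}{1-\eta}\sqrt{\frac{n_{\max}(\log(2n)+t)}{n(n-1)}}\;\|Df\|_1 .$$ -/

import Mathlib

open MeasureTheory ProbabilityTheory Matrix

noncomputable section

/-- The normalized Euclidean norm `‖f‖_n = (∑ f_i² / n)^{1/2}` on `ℝⁿ`. -/
def empNorm {n : ℕ} (f : Fin n → ℝ) : ℝ := √((∑ i, f i ^ 2) / n)

/-- The `ℓ¹`-norm `‖x‖₁ = ∑ |x_i|` on `ℝᵐ`. -/
def l1Norm {m : ℕ} (x : Fin m → ℝ) : ℝ := ∑ i, |x i|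

/-- The set `𝒮(D)` of admissible active sets: all supports of vectors `D f`. -/
def admissibleSets {m n : ℕ} (D : Matrix (Fin m) (Fin n) ℝ) : Set (Set (Fin m)) :=
  {S | ∃ f : Fin n → ℝ, S = {j | (D *ᵥ f) j ≠ 0}}

/-- The matrix `D_{-S}` of the rows of `D` whose index is not in `S`. -/
def rowsOff {m n : ℕ} (D : Matrix (Fin m) (Fin n) ℝ) (S : Set (Fin m)) :
    Matrix {i : Fin m // i ∉ S} (Fin n) ℝ :=
  D.submatrix Subtype.val id

/-- `r_S`, the dimension of the nullspace of `D_{-S}`. -/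
def nullDim {m n : ℕ} (D : Matrix (Fin m) (Fin n) ℝ) (S : Set (Fin m)) : ℕ :=
  Module.finrank ℝ (LinearMap.ker (rowsOff D S).mulVecLin)

/-- `fhat` is a square root analysis estimator for the observation `y`, i.e. a minimizer of
`f ↦ ‖y - f‖_n + lam0 * ‖D f‖₁` over `ℝⁿ`. -/
def IsSqrtAnalysisEstimator {m n : ℕ} (D : Matrix (Fin m) (Fin n) ℝ) (lam0 : ℝ)
    (y fhat : Fin n → ℝ) : Prop :=
  IsMinOn (fun f : Fin n → ℝ => empNorm (y - f) + lam0 * l1Norm (D *ᵥ f)) Set.univ fhat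

/-- The estimator exists for every observation. -/
theorem exists_isSqrtAnalysisEstimator {m n : ℕ} (D : Matrix (Fin m) (Fin n) ℝ) {lam0 : ℝ}
    (h0 : 0 ≤ lam0) (y : Fin n → ℝ) : ∃ fhat, IsSqrtAnalysisEstimator D lam0 y fhat := by
  set J : (Fin n → ℝ) → ℝ := fun f => empNorm (y - f) + lam0 * l1Norm (D *ᵥ f) with hJ
  have hcont : Continuous J := by
    have h1 : Continuous fun f : Fin n → ℝ => D *ᵥ f := Continuous.matrix_mulVec continuous_const
      continuous_id
    have h2 : ∀ i, Continuous fun f : Fin n → ℝ => (D *ᵥ f) i := fun i =>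
      (continuous_apply i).comp h1
    simp only [hJ, empNorm, l1Norm, Pi.sub_apply]
    fun_prop
  have key : ∀ᶠ f in Filter.cocompact (Fin n → ℝ), J y ≤ J f := by
    have ht := tendsto_norm_cocompact_atTop (E := Fin n → ℝ)
    filter_upwards [ht.eventually_ge_atTop (‖y‖ + √n * |J y|)] with f hf
    have hn : 0 ≤ empNorm (y - f) := Real.sqrt_nonneg _
    have hl : 0 ≤ lam0 * l1Norm (D *ᵥ f) :=
      mul_nonneg h0 (Finset.sum_nonneg fun i _ => abs_nonneg _)
    rcases Nat.eq_zero_or_pos n with rfl | hpos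
    · exact le_of_eq (congrArg J (Subsingleton.elim _ _))
    have hsn : 0 < √(n : ℝ) := Real.sqrt_pos.2 (by exact_mod_cast hpos)
    have hsup : ‖y - f‖ ≤ √n * empNorm (y - f) := by
      rw [empNorm, ← Real.sqrt_mul (by positivity), mul_div_cancel₀ _ (by positivity)]
      refine (pi_norm_le_iff_of_nonneg (Real.sqrt_nonneg _)).2 fun i => ?_
      rw [Real.norm_eq_abs]
      refine Real.abs_le_sqrt ?_
      exact Finset.single_le_sum (f := fun j => (y - f) j ^ 2) (fun j _ => sq_nonneg _)
        (Finset.mem_univ i)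
    have h3 : ‖f‖ ≤ ‖y‖ + ‖y - f‖ := by
      have := norm_sub_le y (y - f)
      simpa using this
    have h4 : √n * |J y| ≤ √n * empNorm (y - f) := by linarith
    have h5 := le_of_mul_le_mul_left h4 hsn
    have h6 := le_abs_self (J y)
    show J y ≤ empNorm (y - f) + lam0 * l1Norm (D *ᵥ f)
    linarith
  obtain ⟨x, hx⟩ := hcont.exists_forall_le' y key
  exact ⟨x, fun z _ => hx z⟩

/-- A directed graph with vertex set `[n]` and edge set `{e_1, …, e_m}` without self-loops, where
`e_i` runs from `src i` to `tgt i`. -/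
structure DirGraph (n m : ℕ) where
  src : Fin m → Fin n
  tgt : Fin m → Fin n
  src_ne_tgt : ∀ i, src i ≠ tgt i
  edge_injective : Function.Injective fun i => (src i, tgt i)

namespace DirGraph

variable {n m : ℕ}

/-- The incidence matrix: row `i` has `-1` at the source and `1` at the target of edge `i`. -/
def incidence (G : DirGraph n m) : Matrix (Fin m) (Fin n) ℝ :=
  Matrix.of fun i j => if j = G.src i then -1 else if j = G.tgt i then 1 else 0

/-- The undirected simple graph obtained by deleting the edges with index in `S` and forgetting
the directions of the others. -/
def without (G : DirGraph n m) (S : Set (Fin m)) : SimpleGraph (Fin n) :=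
  SimpleGraph.fromEdgeSet {e | ∃ i, i ∉ S ∧ e = s(G.src i, G.tgt i)}

/-- No two edges join the same pair of vertices, in whatever directions. -/
def NoParallel (G : DirGraph n m) : Prop :=
  Function.Injective fun i => s(G.src i, G.tgt i)

/-- A tree with arbitrary directions of the edges. -/
def IsTreeGraph (G : DirGraph n m) : Prop :=
  G.NoParallel ∧ (G.without ∅).IsTree

/-- A cycle through all `n ≥ 3` vertices with arbitrary directions of the edges. -/
def IsCycleGraph (G : DirGraph n m) : Prop :=
  G.NoParallel ∧ 3 ≤ n ∧ Nonempty (G.without ∅ ≃g SimpleGraph.cycleGraph n)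

/-- `n_max`, the largest number of vertices of a connected component of the graph without the
edges in `S`. -/
def nMax (G : DirGraph n m) (S : Set (Fin m)) : ℕ :=
  ⨆ C : (G.without S).ConnectedComponent, C.supp.ncard

end DirGraph

/-- The constant bounding `lam0 * ‖D f⁰‖₁ / (σ (1 - (8a/n)^{1/2})^{1/2})`. -/
def overfitConst (n r : ℕ) (a η : ℝ) : ℝ :=
  √((η / 2 - (√r + √(2 * a)) / √(n - √(8 * a * n))) ^ 2 + 4) - 2

/-- The standing assumption relating `n`, the active set `S`, the tuning parameter `lam0`, the
signal `f0`, and the parameters `a`, `η`. -/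
structure SqrtAssumption {m n : ℕ} (D : Matrix (Fin m) (Fin n) ℝ) (S : Set (Fin m))
    (f0 : Fin n → ℝ) (σ lam0 a η : ℝ) : Prop where
  a_pos : 0 < a
  n_large : 8 * a < n
  η_mem : η ∈ Set.Ioo (0 : ℝ) 1
  lam0_ge : ∃ R : ℝ, 0 < R ∧ 1 / (1 - η) * R ≤ lam0
  signal_le : l1Norm (D *ᵥ f0) ≤
    overfitConst n (nullDim D S) a η * σ * √(1 - √(8 * a / n)) / lam0
  η_large : 2 * ((√(nullDim D S) + √(2 * a)) / √(n - √(8 * a * n))) < η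

end

/-! After multiplication by `√n` the estimator minimizes `‖y - g‖ + q g` in Euclidean space, with
`q` a multiple of `‖D g‖₁`. Its optimality condition weighs the penalty by the length of the
residual. If this length is at least `(1 - η)‖e‖`, the penalty therefore dominates a noise term
proportional to `‖e‖`; this is why `lam0` need not know `σ`.

Noise: each row `i ∉ S` has a dual vector `d i`, orthogonal to the nullspace of `D_{-S}`, so `⟪e,
h⟫` splits into a projection part, at most `‖P e‖‖h‖`, and a part at most `max |⟪d i, e⟫| · ‖D_{-S}
h‖₁` (`inner_le_of_dual_vectors`). Deleting edge `i` cuts its component in two pieces of sizes `p`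
and `q`, which gives `‖d i‖² = pq/(p+q) ≤ n_max/4` (`exists_dual_vector`).

Residual: convexity and the bound on `‖D f⁰‖₁` exclude overfitting (`norm_residual_ge_of_isMinOn`).
The three-point identity then gives the oracle inequality (`norm_sub_sq_le_of_isMinOn`).

Probability: Chernoff bounds control `‖P e‖`, both tails of `‖e‖`, and the ratios `⟪d i, e⟫²/‖e‖²`,
the last through a union over at most `n` edges. -/

/-! ### Chernoff bounds for Gaussian quadratic forms. -/

lemma integral_exp_mul_sq_gaussianReal {θ : ℝ} (hθ : θ < 1 / 2) :
    ∫ x, Real.exp (θ * x ^ 2) ∂(gaussianReal 0 1) = (√(1 - 2 * θ))⁻¹ := by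
  rw [integral_gaussianReal_eq_integral_smul one_ne_zero]
  have h : ∀ x : ℝ, gaussianPDFReal 0 1 x • Real.exp (θ * x ^ 2)
      = (√(2 * Real.pi))⁻¹ * Real.exp (-(1 / 2 - θ) * x ^ 2) := by
    intro x
    simp only [gaussianPDFReal, smul_eq_mul, NNReal.coe_one, mul_one, sub_zero]
    rw [mul_assoc, ← Real.exp_add]
    congr 2
    ring
  simp_rw [h]
  rw [integral_const_mul, integral_gaussian, ← Real.sqrt_inv, ← Real.sqrt_inv,
    ← Real.sqrt_mul (by positivity)]
  congr 1
  have h1 : (1 - 2 * θ) ≠ 0 := by linarith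
  have h2 : (1 / 2 - θ) ≠ 0 := by linarith
  have := Real.pi_ne_zero
  field_simp

lemma integrable_exp_mul_sq_gaussianReal {θ : ℝ} (hθ : θ < 1 / 2) :
    Integrable (fun x => Real.exp (θ * x ^ 2)) (gaussianReal 0 1) := by
  -- A non-integrable function has Bochner integral `0`, so the nonzero closed form already yields
  -- integrability.
  refine Integrable.of_integral_ne_zero ?_
  rw [integral_exp_mul_sq_gaussianReal hθ]
  have : 0 < 1 - 2 * θ := by linarith
  positivity

section StdGaussian

variable {ι E : Type*} [Fintype ι] [NormedAddCommGroup E] [InnerProductSpace ℝ E]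
  [FiniteDimensional ℝ E] [MeasurableSpace E] [BorelSpace E]

/-- The Chernoff bound for a diagonal quadratic form of a standard Gaussian vector. -/
lemma stdGaussian_real_quadratic_ge_le (b : OrthonormalBasis ι ℝ E) (θ : ι → ℝ)
    (hθ : ∀ i, θ i < 1 / 2) (c : ℝ) :
    (stdGaussian E).real {x | c ≤ ∑ i, θ i * inner ℝ (b i) x ^ 2}
      ≤ Real.exp (-c) * ∏ i, (√(1 - 2 * θ i))⁻¹ := by
  set μ := Measure.pi fun _ : ι => gaussianReal 0 1
  have hmeas : Measurable fun x : ι → ℝ => ∑ i, x i • b i := by fun_prop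
  have hset : MeasurableSet {x : E | c ≤ ∑ i, θ i * inner ℝ (b i) x ^ 2} :=
    measurableSet_le (by fun_prop) (by fun_prop)
  rw [stdGaussian_eq_map_pi_orthonormalBasis b, map_measureReal_apply hmeas hset]
  have hpre : (fun x : ι → ℝ => ∑ i, x i • b i) ⁻¹' {x : E | c ≤ ∑ i, θ i * inner ℝ (b i) x ^ 2}
      = {x : ι → ℝ | Real.exp c ≤ ∏ i, Real.exp (θ i * x i ^ 2)} := by
    ext x
    simp only [Set.mem_preimage, Set.mem_ofPred_eq]
    rw [← Real.exp_sum, Real.exp_le_exp]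
    have : ∀ i, inner ℝ (b i) (∑ j, x j • b j) = x i := fun i => by
      simpa using b.orthonormal.inner_right_fintype x i
    simp_rw [this]
  rw [hpre]
  have hint : Integrable (fun x : ι → ℝ => ∏ i, Real.exp (θ i * x i ^ 2)) μ :=
    Integrable.fintype_prod (f := fun i x => Real.exp (θ i * x ^ 2))
      fun i => integrable_exp_mul_sq_gaussianReal (hθ i)
  have hM := mul_meas_ge_le_integral_of_nonneg (μ := μ)
    (Filter.Eventually.of_forall fun x => Finset.prod_nonneg fun i _ => (Real.exp_pos _).le)
    hint (Real.exp c)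
  rw [integral_fintype_prod_eq_prod (f := fun i x => Real.exp (θ i * x ^ 2))] at hM
  simp_rw [integral_exp_mul_sq_gaussianReal (hθ _)] at hM
  rw [Real.exp_neg, ← div_eq_inv_mul, le_div_iff₀ (Real.exp_pos _), mul_comm]
  exact hM

lemma stdGaussian_real_mul_norm_sq_ge_le {θ : ℝ} (hθ : θ < 1 / 2) (c : ℝ) :
    (stdGaussian E).real {x | c ≤ θ * ‖x‖ ^ 2}
      ≤ Real.exp (-c) * (√(1 - 2 * θ))⁻¹ ^ Module.finrank ℝ E := by
  have h := stdGaussian_real_quadratic_ge_le (stdOrthonormalBasis ℝ E) (fun _ => θ)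
    (fun _ => hθ) c
  simp only [← Finset.mul_sum, Finset.prod_const, Finset.card_univ, Fintype.card_fin] at h
  have h2 : ∀ x : E, ∑ i, inner ℝ (stdOrthonormalBasis ℝ E i) x ^ 2 = ‖x‖ ^ 2 := fun x => by
    rw [← (stdOrthonormalBasis ℝ E).sum_sq_norm_inner_right x]
    simp [sq_abs]
  simpa only [h2] using h

/-- The upper tail of the norm of a standard Gaussian vector. -/
lemma stdGaussian_real_norm_gt_le {a : ℝ} (ha : 0 < a) :
    (stdGaussian E).real {x | √(Module.finrank ℝ E) + √(2 * a) < ‖x‖} ≤ Real.exp (-a) := by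
  rcases Nat.eq_zero_or_pos (Module.finrank ℝ E) with h0 | hpos
  · have : Subsingleton E := Module.finrank_zero_iff.1 h0
    have hemp : {x : E | √(Module.finrank ℝ E) + √(2 * a) < ‖x‖} = ∅ := by
      ext x
      simp only [Set.mem_ofPred_eq, Set.mem_empty_iff_false, iff_false, not_lt]
      rw [Subsingleton.elim x 0, norm_zero]
      positivity
    rw [hemp, measureReal_empty]
    positivity
  set r : ℝ := (Module.finrank ℝ E : ℝ) with hr
  have hr0 : 0 < r := Nat.cast_pos.2 hpos
  set w := √r with hw
  set z := √(2 * a) with hz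
  have hw0 : 0 < w := Real.sqrt_pos.2 hr0
  have hz0 : 0 < z := Real.sqrt_pos.2 (by linarith)
  have hw2 : w ^ 2 = r := Real.sq_sqrt hr0.le
  have hz2 : z ^ 2 = 2 * a := Real.sq_sqrt (by linarith)
  -- The optimal Chernoff parameter for the level `(w + z)²` satisfies `1 - 2θ = w²/(w + z)² = ρ²`.
  set ρ := w / (w + z) with hρ
  have hρ0 : 0 < ρ := by positivity
  have hρ1 : ρ < 1 := by rw [hρ, div_lt_one (by positivity)]; linarith
  set θ := (1 - ρ ^ 2) / 2 with hθ
  have hθ0 : 0 < θ := by rw [hθ]; nlinarith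
  have hθ1 : θ < 1 / 2 := by rw [hθ]; nlinarith [sq_nonneg ρ, pow_pos hρ0 2]
  have hsq : √(1 - 2 * θ) = ρ := by
    rw [show 1 - 2 * θ = ρ ^ 2 by rw [hθ]; ring, Real.sqrt_sq hρ0.le]
  have hb := stdGaussian_real_mul_norm_sq_ge_le (E := E) hθ1 (θ * (w + z) ^ 2)
  rw [hsq] at hb
  refine (measureReal_mono ?_).trans (hb.trans ?_)
  · intro x (hx : w + z < ‖x‖)
    show θ * (w + z) ^ 2 ≤ θ * ‖x‖ ^ 2
    gcongr
  have hinv : ρ⁻¹ = 1 + z / w := by rw [hρ]; field_simp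
  have h1 : ρ⁻¹ ≤ Real.exp (z / w) := by
    rw [hinv, add_comm]; exact Real.add_one_le_exp _
  calc Real.exp (-(θ * (w + z) ^ 2)) * ρ⁻¹ ^ Module.finrank ℝ E
      ≤ Real.exp (-(θ * (w + z) ^ 2)) * Real.exp (z / w) ^ Module.finrank ℝ E := by gcongr
    _ = Real.exp (-a) := by
      rw [← Real.exp_nat_mul, ← hr, ← Real.exp_add]
      congr 1
      have hθw : θ * (w + z) ^ 2 = ((w + z) ^ 2 - w ^ 2) / 2 := by
        rw [hθ, hρ]; field_simp
      rw [hθw, ← hw2]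
      field_simp
      linarith

/-- The lower tail of the norm of a standard Gaussian vector. -/
lemma stdGaussian_real_norm_sq_lt_le {a : ℝ} (ha : 0 < a)
    (hn : 8 * a < Module.finrank ℝ E) :
    (stdGaussian E).real {x | ‖x‖ ^ 2 < Module.finrank ℝ E - √(8 * a * Module.finrank ℝ E)}
      ≤ Real.exp (-a) := by
  set n : ℝ := (Module.finrank ℝ E : ℝ) with hnn
  have hn0 : 0 < n := by linarith
  set v := √(8 * a / n) with hv
  have hv0 : 0 < v := Real.sqrt_pos.2 (by positivity)
  have hv2 : v ^ 2 = 8 * a / n := Real.sq_sqrt (by positivity)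
  have hv1 : v < 1 := by
    have : v ^ 2 < 1 := by rw [hv2, div_lt_one hn0]; exact hn
    nlinarith
  have hs : √(8 * a * n) = n * v := by
    rw [show 8 * a * n = n ^ 2 * (8 * a / n) by field_simp, Real.sqrt_mul (by positivity),
      Real.sqrt_sq hn0.le]
  have hv1' : 0 < 1 - v := by linarith
  -- Again the Chernoff optimum: `1 + 2θ = 1/(1 - v)`. With `log (1 - v) ≤ -v - v²/2` the exponent
  -- becomes `-n v²/4 = -2a`.
  set θ := v / (2 * (1 - v)) with hθ
  have hθ0 : 0 < θ := by positivity
  have hb := stdGaussian_real_mul_norm_sq_ge_le (E := E) (θ := -θ) (by linarith) (-(θ * (n * (1 - v))))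
  have hinv : (√(1 - 2 * -θ))⁻¹ = √(1 - v) := by
    rw [← Real.sqrt_inv]
    congr 1
    rw [hθ]; field_simp; ring
  rw [hinv] at hb
  refine (measureReal_mono ?_).trans (hb.trans ?_)
  · intro x (hx : ‖x‖ ^ 2 < n - √(8 * a * n))
    show -(θ * (n * (1 - v))) ≤ -θ * ‖x‖ ^ 2
    rw [hs] at hx
    nlinarith
  have hlog : Real.log (1 - v) ≤ -v - v ^ 2 / 2 := by
    have := Real.hasSum_pow_div_log_of_abs_lt_one (x := v) (by rw [abs_lt]; constructor <;> linarith)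
    have h2 := this.summable.sum_le_tsum (Finset.range 2) (fun i _ => by positivity)
    rw [this.tsum_eq] at h2
    norm_num [Finset.sum_range_succ] at h2
    linarith
  have h1 : √(1 - v) ≤ Real.exp ((-v - v ^ 2 / 2) / 2) := by
    rw [Real.sqrt_le_left (Real.exp_pos _).le, ← Real.exp_nat_mul]
    rw [← Real.log_le_iff_le_exp hv1']
    push_cast
    linarith
  calc Real.exp (-(-(θ * (n * (1 - v))))) * √(1 - v) ^ Module.finrank ℝ E
      ≤ Real.exp (-(-(θ * (n * (1 - v))))) *
          Real.exp ((-v - v ^ 2 / 2) / 2) ^ Module.finrank ℝ E := by gcongr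
    _ ≤ Real.exp (-a) := by
      rw [← Real.exp_nat_mul, ← hnn, ← Real.exp_add, Real.exp_le_exp]
      have hθw : θ * (n * (1 - v)) = n * v / 2 := by rw [hθ]; field_simp
      have : n * v ^ 2 = 8 * a := by rw [hv2]; field_simp
      rw [neg_neg, hθw]
      nlinarith

/-- The orthogonal projection of a standard Gaussian vector is standard Gaussian. -/
lemma stdGaussian_map_orthogonalProjection (N : Submodule ℝ E) :
    (stdGaussian E).map N.orthogonalProjectionOnto = stdGaussian N := by
  have : IsProbabilityMeasure ((stdGaussian E).map N.orthogonalProjectionOnto) :=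
    Measure.isProbabilityMeasure_map (by fun_prop)
  refine Measure.ext_of_charFun ?_
  ext t
  rw [charFun_stdGaussian, charFun_apply, integral_map (by fun_prop) (by fun_prop)]
  have h : ∀ x : E, inner ℝ (N.orthogonalProjectionOnto x) t = inner ℝ x (t : E) := fun x => by
    rw [N.inner_orthogonalProjectionOnto_eq_of_mem_right]
  simp_rw [h]
  rw [← charFun_apply, charFun_stdGaussian]
  simp

lemma stdGaussian_real_norm_orthogonalProjection_gt_le (N : Submodule ℝ E) {a : ℝ} (ha : 0 < a) :
    (stdGaussian E).real {x | √(Module.finrank ℝ N) + √(2 * a) < ‖N.orthogonalProjectionOnto x‖}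
      ≤ Real.exp (-a) := by
  have h := stdGaussian_real_norm_gt_le (E := N) ha
  rw [← stdGaussian_map_orthogonalProjection N, map_measureReal_apply (by fun_prop)
    (measurableSet_lt (by fun_prop) (by fun_prop))] at h
  exact h

/-- The self-normalized tail of a linear form of a standard Gaussian vector. -/
lemma stdGaussian_real_inner_sq_gt_le_of_norm_eq_one {u : E} (hu : ‖u‖ = 1) {s : ℝ} (hs0 : 0 ≤ s)
    (hs1 : s ≤ 1) :
    (stdGaussian E).real {x | s * ‖x‖ ^ 2 < inner ℝ u x ^ 2}
      ≤ 2 * Real.exp (-((Module.finrank ℝ E - 1) * s / 4)) := by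
  classical
  obtain ⟨I, b, hI, hb⟩ := (show Orthonormal ℝ (Subtype.val : ({u} : Set E) → E) by
    constructor
    · rintro ⟨x, rfl⟩; exact hu
    · rintro ⟨x, rfl⟩ ⟨y, rfl⟩ h; exact absurd rfl h).exists_orthonormalBasis_extension
  let j : I := ⟨u, hI rfl⟩
  have hbj : b j = u := by rw [hb]
  have hcard : Fintype.card I = Module.finrank ℝ E := (Module.finrank_eq_card_basis b.toBasis).symm
  have hcardpos : 1 ≤ Fintype.card I := Fintype.card_pos_iff.2 ⟨j⟩
  -- The event is scale invariant, so it is a quadratic form at level `0`. With the factor `3/8`,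
  -- direction `j` costs at most `2`, because `1 - 2θ_j ≥ 1/4`. Each other direction contributes `(1
  -- + 3s/4)^(-1/2) ≤ e^(-s/4)`.
  have h := stdGaussian_real_quadratic_ge_le b
    (fun i => 3 / 8 * ((if i = j then 1 else 0) - s)) (fun i => by split_ifs <;> linarith) 0
  refine (measureReal_mono ?_).trans (h.trans ?_)
  · intro x (hx : s * ‖x‖ ^ 2 < inner ℝ u x ^ 2)
    show 0 ≤ ∑ i, 3 / 8 * ((if i = j then 1 else 0) - s) * inner ℝ (b i) x ^ 2
    have h2 : ∑ i, inner ℝ (b i) x ^ 2 = ‖x‖ ^ 2 := by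
      rw [← b.sum_sq_norm_inner_right x]
      simp [sq_abs]
    have : ∑ i, 3 / 8 * ((if i = j then 1 else 0) - s) * inner ℝ (b i) x ^ 2
        = 3 / 8 * (inner ℝ u x ^ 2 - s * ‖x‖ ^ 2) := by
      rw [← h2, ← hbj]
      simp only [mul_sub, sub_mul, Finset.sum_sub_distrib, Finset.mul_sum]
      simp [mul_assoc]
    rw [this]
    linarith
  rw [neg_zero, Real.exp_zero, one_mul, ← Finset.mul_prod_erase _ _ (Finset.mem_univ j)]
  -- On `[0, 1]` the convex exponential lies below its chord, and `e^(1/2) ≤ 7/4`.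
  have hexp : Real.exp (s / 2) ≤ 1 + 3 / 4 * s := by
    have hc := convexOn_exp.2 (Set.mem_univ 0) (Set.mem_univ (1 / 2)) (sub_nonneg.2 hs1) hs0
      (by ring)
    simp only [smul_eq_mul, Real.exp_zero] at hc
    have he : Real.exp (1 / 2) ≤ 7 / 4 := by
      have h1 : Real.exp (1 / 2) ^ 2 = Real.exp 1 := by
        rw [← Real.exp_nat_mul]; norm_num
      have := Real.exp_one_lt_d9
      nlinarith [Real.exp_pos (1 / 2)]
    rw [show s / 2 = (1 - s) * 0 + s * (1 / 2) by ring]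
    nlinarith
  have hfac : (√(1 + 3 / 4 * s))⁻¹ ≤ Real.exp (-(s / 4)) := by
    rw [Real.exp_neg]
    gcongr
    refine Real.le_sqrt_of_sq_le ?_
    rw [← Real.exp_nat_mul]
    refine le_trans (le_of_eq ?_) hexp
    congr 1; push_cast; ring
  refine mul_le_mul ?_ ?_ (Finset.prod_nonneg fun i _ => by positivity) (by norm_num)
  · rw [inv_le_comm₀ (Real.sqrt_pos.2 (by simp; linarith)) two_pos]
    refine Real.le_sqrt_of_sq_le ?_
    simp
    linarith
  · calc ∏ i ∈ Finset.univ.erase j, (√(1 - 2 * (3 / 8 * ((if i = j then 1 else 0) - s))))⁻¹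
        = ∏ i ∈ Finset.univ.erase j, (√(1 + 3 / 4 * s))⁻¹ := by
          refine Finset.prod_congr rfl fun i hi => ?_
          rw [if_neg (Finset.ne_of_mem_erase hi)]
          congr 2; ring
      _ = (√(1 + 3 / 4 * s))⁻¹ ^ (Fintype.card I - 1) := by
          rw [Finset.prod_const, Finset.card_erase_of_mem (Finset.mem_univ _), Finset.card_univ]
      _ ≤ Real.exp (-(s / 4)) ^ (Fintype.card I - 1) := by gcongr
      _ = Real.exp (-((Module.finrank ℝ E - 1) * s / 4)) := by
          rw [← Real.exp_nat_mul, Nat.cast_sub hcardpos, hcard]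
          congr 1; push_cast; ring

/-- Homogeneity in `d` reduces to unit vectors with `s = 4A/(dim - 1)`. If `d = 0` or `s > 1`, the
event is empty by Cauchy–Schwarz. -/
lemma stdGaussian_real_inner_sq_gt_le (d : E) {A M : ℝ} (hA : 0 ≤ A)
    (hE : 1 < Module.finrank ℝ E) (hd : 4 * ‖d‖ ^ 2 ≤ M) :
    (stdGaussian E).real {x | M * A / (Module.finrank ℝ E - 1) * ‖x‖ ^ 2 < inner ℝ d x ^ 2}
      ≤ 2 * Real.exp (-A) := by
  have hn : (0 : ℝ) < Module.finrank ℝ E - 1 := by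
    have : (1 : ℝ) < Module.finrank ℝ E := by exact_mod_cast hE
    linarith
  set s : ℝ := 4 * A / (Module.finrank ℝ E - 1) with hs
  have hs0 : 0 ≤ s := by positivity
  have key : ∀ x : E, M * A / (Module.finrank ℝ E - 1) * ‖x‖ ^ 2 < inner ℝ d x ^ 2 →
      ‖d‖ ^ 2 * (s * ‖x‖ ^ 2) < inner ℝ d x ^ 2 := by
    intro x hx
    refine lt_of_le_of_lt ?_ hx
    rw [← mul_assoc]
    gcongr
    rw [hs, ← mul_div_assoc]
    gcongr ?_ / _
    nlinarith
  by_cases hgood : d ≠ 0 ∧ s ≤ 1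
  · obtain ⟨hd0, hs1⟩ := hgood
    have hd' : 0 < ‖d‖ := norm_pos_iff.2 hd0
    have h := stdGaussian_real_inner_sq_gt_le_of_norm_eq_one (u := ‖d‖⁻¹ • d)
      (by rw [norm_smul, norm_inv, norm_norm, inv_mul_cancel₀ hd'.ne']) hs0 hs1
    refine (measureReal_mono ?_).trans (h.trans (le_of_eq ?_))
    · intro x hx
      have := key x hx
      show s * ‖x‖ ^ 2 < inner ℝ (‖d‖⁻¹ • d) x ^ 2
      rw [real_inner_smul_left, mul_pow, inv_pow, ← div_eq_inv_mul, lt_div_iff₀ (by positivity)]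
      linarith
    · congr 3
      rw [hs]; field_simp
  · have hemp : {x | M * A / (Module.finrank ℝ E - 1) * ‖x‖ ^ 2 < inner ℝ d x ^ 2} = ∅ := by
      ext x
      simp only [Set.mem_ofPred_eq, Set.mem_empty_iff_false, iff_false]
      intro hx
      have h1 := key x hx
      have h2 : inner ℝ d x ^ 2 ≤ ‖d‖ ^ 2 * ‖x‖ ^ 2 := by
        rw [← mul_pow, ← sq_abs]
        gcongr
        exact abs_real_inner_le_norm d x
      rw [not_and_or, not_not, not_le] at hgood
      rcases hgood with rfl | hs1
      · simp at h1
      · have : ‖d‖ ^ 2 * (1 * ‖x‖ ^ 2) ≤ ‖d‖ ^ 2 * (s * ‖x‖ ^ 2) := by gcongr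
        linarith
    rw [hemp, measureReal_empty]
    positivity

end StdGaussian

/-! ### Deterministic analysis of square root regularization. -/

section SqrtRegularization

variable {E : Type*} [NormedAddCommGroup E] [InnerProductSpace ℝ E]

/-- The variational inequality of a minimizer of `g ↦ ‖y - g‖ + q g`. -/
lemma inner_residual_le_of_isMinOn (q : Seminorm ℝ E) {y fhat : E}
    (hmin : ∀ g, ‖y - fhat‖ + q fhat ≤ ‖y - g‖ + q g) (f : E) :
    inner ℝ (y - fhat) (f - fhat) ≤ ‖y - fhat‖ * (q f - q fhat) := by
  set e := y - fhat with he
  set v := f - fhat with hv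
  have key : ∀ τ : ℝ, 0 < τ → τ ≤ 1 →
      inner ℝ e v ≤ ‖e‖ * (q f - q fhat) + τ * (‖v‖ ^ 2 / 2) := by
    intro τ h0 h1
    have hm := hmin (fhat + τ • v)
    have hq : q (fhat + τ • v) ≤ (1 - τ) * q fhat + τ * q f := by
      have : fhat + τ • v = (1 - τ) • fhat + τ • f := by rw [hv]; module
      rw [this]
      refine (map_add_le_add q _ _).trans ?_
      rw [map_smul_eq_mul, map_smul_eq_mul, Real.norm_of_nonneg h0.le,
        Real.norm_of_nonneg (by linarith)]
    rw [← sub_sub, ← he] at hm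
    have h2 : ‖e‖ - τ * (q f - q fhat) ≤ ‖e - τ • v‖ := by linarith
    have h3 : ‖e - τ • v‖ ^ 2 = ‖e‖ ^ 2 - 2 * (τ * inner ℝ e v) + τ ^ 2 * ‖v‖ ^ 2 := by
      rw [norm_sub_sq_real, real_inner_smul_right, norm_smul, mul_pow, Real.norm_of_nonneg h0.le]
    -- From `x² ≥ 2‖e‖x - ‖e‖²`; no division by `‖e‖`, so a zero residual is covered.
    have h4 : ‖e‖ ^ 2 - 2 * (τ * (‖e‖ * (q f - q fhat))) ≤ ‖e - τ • v‖ ^ 2 := by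
      nlinarith [sq_nonneg (‖e - τ • v‖ - ‖e‖), norm_nonneg e]
    rw [h3] at h4
    have h5 : τ * inner ℝ e v ≤ τ * (‖e‖ * (q f - q fhat) + τ * (‖v‖ ^ 2 / 2)) := by nlinarith
    exact le_of_mul_le_mul_left h5 h0
  refine le_of_forall_pos_le_add fun δ hδ => ?_
  have hV : 0 < ‖v‖ ^ 2 / 2 + 1 := by positivity
  have := key (min 1 (δ / (‖v‖ ^ 2 / 2 + 1))) (by positivity) (min_le_left _ _)
  refine this.trans ?_
  gcongr
  calc min 1 (δ / (‖v‖ ^ 2 / 2 + 1)) * (‖v‖ ^ 2 / 2)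
      ≤ δ / (‖v‖ ^ 2 / 2 + 1) * (‖v‖ ^ 2 / 2 + 1) := by
        gcongr
        · exact min_le_right _ _
        · linarith
    _ = δ := by field_simp

/-- A minimizer of `g ↦ ‖f0 + e - g‖ + q g` does not overfit. -/
lemma norm_residual_ge_of_isMinOn (q q' : Seminorm ℝ E) (hqq : ∀ g, q' g ≤ q g) {f0 e fhat : E}
    (hmin : ∀ g, ‖f0 + e - fhat‖ + q fhat ≤ ‖f0 + e - g‖ + q g) {η ρ c : ℝ}
    (hη0 : 0 < η) (hη1 : η < 1) (he : 0 < ‖e‖) (hρ0 : 0 ≤ ρ) (hρ : 2 * ρ < η)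
    (hinner : ∀ h, inner ℝ e h ≤ ρ * ‖e‖ * ‖h‖ + (1 - η) * ‖e‖ * q' h)
    (hc : (c + 2) ^ 2 = (η / 2 - ρ) ^ 2 + 4) (hf0 : q f0 ≤ c * ‖e‖) :
    (1 - η) * ‖e‖ ≤ ‖f0 + e - fhat‖ := by
  set h := fhat - f0 with hh
  have hres : f0 + e - fhat = e - h := by rw [hh]; abel
  suffices hle : ‖h‖ ≤ η * ‖e‖ by
    rw [hres]
    have := norm_sub_norm_le e h
    linarith
  by_contra! hgt
  have hhpos : 0 < ‖h‖ := lt_trans (by positivity) hgt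
  -- Shrink the error to length exactly `η‖e‖`; by convexity the objective there is still at most
  -- its value at `f0`.
  set τ := η * ‖e‖ / ‖h‖ with hτ
  have hτ0 : 0 < τ := by positivity
  have hτ1 : τ ≤ 1 := by rw [hτ, div_le_one hhpos]; exact hgt.le
  set g := τ • h with hg
  have hgn : ‖g‖ = η * ‖e‖ := by
    rw [hg, norm_smul, Real.norm_of_nonneg hτ0.le, hτ]; field_simp
  have hobj : ‖e - g‖ + q (f0 + g) ≤ ‖e‖ + q f0 := by
    have h1 : ‖e - g‖ ≤ (1 - τ) * ‖e‖ + τ * ‖e - h‖ := by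
      have : e - g = (1 - τ) • e + τ • (e - h) := by rw [hg]; module
      rw [this]
      refine (norm_add_le _ _).trans ?_
      rw [norm_smul, norm_smul, Real.norm_of_nonneg hτ0.le, Real.norm_of_nonneg (by linarith)]
    have h2 : q (f0 + g) ≤ (1 - τ) * q f0 + τ * q fhat := by
      have : f0 + g = (1 - τ) • f0 + τ • fhat := by rw [hg, hh]; module
      rw [this]
      refine (map_add_le_add q _ _).trans ?_
      rw [map_smul_eq_mul, map_smul_eq_mul, Real.norm_of_nonneg hτ0.le,
        Real.norm_of_nonneg (by linarith)]
    have h3 := hmin f0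
    rw [hres, add_sub_cancel_left] at h3
    nlinarith
  have hqg : q' g ≤ ‖e‖ + 2 * q f0 - ‖e - g‖ := by
    have : q g ≤ q (f0 + g) + q f0 := by
      have := map_sub_le_add q (f0 + g) f0
      rwa [add_sub_cancel_left] at this
    linarith [hqq g]
  have hx : ‖e - g‖ ^ 2 = ‖e‖ ^ 2 - 2 * inner ℝ e g + η ^ 2 * ‖e‖ ^ 2 := by
    rw [norm_sub_sq_real, hgn]; ring
  have hin := hinner g
  rw [hgn] at hin
  have hxlow : (1 - η) * ‖e‖ ≤ ‖e - g‖ := by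
    have := norm_sub_norm_le e g
    rw [hgn] at this
    linarith
  have hp0 : 0 ≤ q f0 := apply_nonneg q f0
  have hxup : ‖e - g‖ ≤ ‖e‖ + q f0 := by linarith [apply_nonneg q (f0 + g)]
  generalize ‖e - g‖ = x at *
  generalize q f0 = p at *
  generalize ‖e‖ = N at *
  have h1 : inner ℝ e g ≤ ρ * N * (η * N) + (1 - η) * N * (N + 2 * p - x) :=
    hin.trans (by gcongr)
  have h2 : (x - (1 - η) * N) * (x - N - p) ≤ 0 :=
    mul_nonpos_of_nonneg_of_nonpos (by linarith) (by linarith)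
  have hc0 : 0 ≤ c := by
    by_contra! hneg
    nlinarith
  -- This fixes the form of `c`: `c² + 4c = (η/2 - ρ)²`. The right side of `h6` is convex in `x`
  -- with vertex `(1 - η)N`, so on the allowed range it is largest at `x = N + p`, where it is at
  -- most `p² + 4pN`. The left side exceeds this by the positive quantity in `h5`.
  have h3 : p ^ 2 + 4 * p * N ≤ (η / 2 - ρ) ^ 2 * N ^ 2 := by
    have : p ^ 2 + 4 * p * N ≤ (c * N) ^ 2 + 4 * (c * N) * N := by gcongr
    nlinarith
  have h5 : 0 < (η / 2 - ρ) * (3 * η / 2 + ρ) * N ^ 2 := by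
    have : 0 < η / 2 - ρ := by linarith
    positivity
  have h6 : (η ^ 2 - 2 * ρ * η) * N ^ 2 ≤ x ^ 2 - N ^ 2 + 2 * (1 - η) * N * (N + 2 * p - x) := by
    linarith
  have h7 : 0 ≤ (η * N + p) * (N + p - x) := mul_nonneg (by positivity) (by linarith)
  have h8 : 0 ≤ η * N * p := by positivity
  linarith

lemma norm_residual_le_of_isMinOn (q : Seminorm ℝ E) {f0 e fhat : E}
    (hmin : ∀ g, ‖f0 + e - fhat‖ + q fhat ≤ ‖f0 + e - g‖ + q g) :
    ‖f0 + e - fhat‖ ≤ ‖e‖ + q f0 := by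
  have h := hmin f0
  rw [add_sub_cancel_left] at h
  linarith [apply_nonneg q fhat]

/-- The deterministic oracle inequality. -/
lemma norm_sub_sq_le_of_isMinOn (q q' : Seminorm ℝ E) (hqq : ∀ g, q' g ≤ q g) {f0 e fhat : E}
    (hmin : ∀ g, ‖f0 + e - fhat‖ + q fhat ≤ ‖f0 + e - g‖ + q g) {η W : ℝ}
    (hinner : ∀ h, inner ℝ e h ≤ W * ‖h‖ + (1 - η) * ‖e‖ * q' h)
    (hres : (1 - η) * ‖e‖ ≤ ‖f0 + e - fhat‖) (f : E) :
    ‖fhat - f0‖ ^ 2 ≤ ‖f - f0‖ ^ 2 + W ^ 2 + 4 * ‖f0 + e - fhat‖ * q f := by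
  have h1 := inner_residual_le_of_isMinOn q hmin f
  have h2 := hinner (fhat - f)
  have h3 : q' (fhat - f) ≤ q fhat + q f :=
    (map_sub_le_add q' _ _).trans (add_le_add (hqq _) (hqq _))
  have h4 : (1 - η) * ‖e‖ * q' (fhat - f) ≤ ‖f0 + e - fhat‖ * (q fhat + q f) :=
    mul_le_mul hres h3 (apply_nonneg _ _) (norm_nonneg _)
  have h5 : ‖fhat - f0‖ ^ 2 - ‖f - f0‖ ^ 2 + ‖fhat - f‖ ^ 2
      = 2 * inner ℝ e (fhat - f) + 2 * inner ℝ (f0 + e - fhat) (f - fhat) := by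
    have e1 : f - f0 = (fhat - f0) - (fhat - f) := by abel
    have e2 : f0 + e - fhat = e - (fhat - f0) := by abel
    have e3 : f - fhat = -(fhat - f) := by abel
    rw [e2, e1, norm_sub_sq_real (fhat - f0), e3, inner_neg_right, inner_sub_left e]
    ring
  -- The terms in `q fhat` cancel, and `2W‖fhat - f‖ ≤ W² + ‖fhat - f‖²` absorbs the projection
  -- part.
  nlinarith [sq_nonneg (W - ‖fhat - f‖)]

end SqrtRegularization

/-! ### Bridges, components and dual vectors of the graph. -/

lemma SimpleGraph.Reachable.mem_of_forall_adj {V : Type*} {H : SimpleGraph V} {u v : V}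
    (h : H.Reachable u v) {p : V → Prop} (hp : ∀ x y, H.Adj x y → p x → p y) (hu : p u) : p v := by
  obtain ⟨w⟩ := h
  induction w with
  | nil => exact hu
  | cons hadj _ ih => exact ih (hp _ _ hadj hu)

/-- Deleting two edges of the cycle on `Fin n` separates the endpoints of each. -/
lemma SimpleGraph.not_reachable_of_le_cycleGraph {n : ℕ} (H : SimpleGraph (Fin (n + 3)))
    (hH : H ≤ SimpleGraph.cycleGraph (n + 3)) {a b : Fin (n + 3)} (hab : a ≠ b)
    (ha : ¬ H.Adj a (a + 1)) (hb : ¬ H.Adj b (b + 1)) : ¬ H.Reachable a (a + 1) := by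
  -- After rotating `a + 1` to `0`, the arc from `a + 1` to `b` is the initial segment up to `B`.
  -- Only the two missing edges could leave it, and `a`, rotated to the last vertex, lies outside.
  set B := b - (a + 1) with hB
  have hBne : B ≠ -1 := by
    intro h
    apply hab
    have : b = B + (a + 1) := by rw [hB]; abel
    rw [this, h]; abel
  have step : ∀ x : Fin (n + 3), x ≠ a → x ≠ b →
      (x - (a + 1) ≤ B ↔ x + 1 - (a + 1) ≤ B) := by
    intro x hxa hxb
    set y := x - (a + 1) with hy
    have hx : x = y + (a + 1) := by rw [hy]; abel
    have hy1 : y ≠ -1 := by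
      intro h
      apply hxa
      rw [hx, h]; abel
    have hyB : y ≠ B := by
      intro h
      apply hxb
      rw [hx, h, hB]; abel
    have e : x + 1 - (a + 1) = y + 1 := by rw [hx]; abel
    rw [e]
    have hlast : y ≠ Fin.last (n + 2) := by
      intro h
      apply hy1
      rw [h, eq_neg_iff_add_eq_zero]
      exact Fin.last_add_one _
    have hval : (y + 1).val = y.val + 1 := Fin.val_add_one_of_lt (Fin.lt_last_iff_ne_last.2 hlast)
    rw [Fin.le_def, Fin.le_def, hval]
    have : y.val ≠ B.val := fun h => hyB (Fin.ext h)
    omega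
  intro hr
  have hiff := hr.mem_of_forall_adj (p := fun x => ¬ (x - (a + 1) ≤ B)) ?_ ?_
  · apply hiff
    rw [sub_self]
    exact Fin.zero_le _
  · intro x y hxy
    have hc := hH hxy
    rw [SimpleGraph.cycleGraph_adj] at hc
    rcases hc with hc | hc
    · have hx : x = y + 1 := by rw [← hc]; abel
      subst hx
      have h1 : y ≠ a := fun h => ha (h ▸ hxy.symm)
      have h2 : y ≠ b := fun h => hb (h ▸ hxy.symm)
      rw [step y h1 h2]
      exact id
    · have hy : y = x + 1 := by rw [← hc]; abel
      subst hy
      have h1 : x ≠ a := fun h => ha (h ▸ hxy)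
      have h2 : x ≠ b := fun h => hb (h ▸ hxy)
      rw [step x h1 h2]
      exact id
  · have : a - (a + 1) = Fin.last (n + 2) := by
      have : Fin.last (n + 2) = -1 := by
        rw [eq_neg_iff_add_eq_zero]; exact Fin.last_add_one _
      rw [this]; abel
    rw [this, Fin.last_le_iff]
    intro h
    apply hBne
    rw [h, eq_neg_iff_add_eq_zero]
    exact Fin.last_add_one _

namespace DirGraph

variable {n m : ℕ} (G : DirGraph n m)

lemma without_adj {S : Set (Fin m)} {u v : Fin n} :
    (G.without S).Adj u v ↔ ∃ i, i ∉ S ∧ s(u, v) = s(G.src i, G.tgt i) := by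
  rw [without, SimpleGraph.fromEdgeSet_adj]
  constructor
  · exact fun h => h.1
  · rintro ⟨i, hi, h⟩
    refine ⟨⟨i, hi, h⟩, ?_⟩
    rintro rfl
    have := G.src_ne_tgt i
    rw [eq_comm, Sym2.eq_iff] at h
    rcases h with h | h <;> exact this (h.1.trans h.2.symm)

lemma without_anti {S T : Set (Fin m)} (h : S ⊆ T) : G.without T ≤ G.without S := by
  intro u v huv
  rw [without_adj] at huv ⊢
  obtain ⟨i, hi, e⟩ := huv
  exact ⟨i, fun hS => hi (h hS), e⟩

lemma without_adj_src_tgt {S : Set (Fin m)} {i : Fin m} (hi : i ∉ S) :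
    (G.without S).Adj (G.src i) (G.tgt i) :=
  G.without_adj.2 ⟨i, hi, rfl⟩

lemma not_without_adj_src_tgt (hG : G.NoParallel) {S : Set (Fin m)} {i : Fin m} (hi : i ∈ S) :
    ¬ (G.without S).Adj (G.src i) (G.tgt i) := by
  rw [without_adj]
  rintro ⟨k, hk, e⟩
  exact hk (hG e ▸ hi)

lemma incidence_mulVec (v : Fin n → ℝ) (i : Fin m) :
    (G.incidence *ᵥ v) i = v (G.tgt i) - v (G.src i) := by
  have h : ∀ j, G.incidence i j * v j
      = (if j = G.tgt i then v j else 0) - (if j = G.src i then v j else 0) := by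
    intro j
    have := G.src_ne_tgt i
    simp only [incidence, Matrix.of_apply]
    split_ifs with h1 h2 <;> simp_all
  rw [Matrix.mulVec, dotProduct]
  simp [h, Finset.sum_sub_distrib]

/-- In the graph without the edges in `S`, every edge is a bridge. -/
lemma not_reachable_without_insert (hG : G.IsTreeGraph ∨ G.IsCycleGraph) {S : Set (Fin m)}
    (hS : G.IsCycleGraph → S.Nonempty) {i : Fin m} (hi : i ∉ S) :
    ¬ (G.without (insert i S)).Reachable (G.src i) (G.tgt i) := by
  rcases hG with ⟨hpar, htree⟩ | hcyc
  · have hb := SimpleGraph.isAcyclic_iff_forall_adj_isBridge.1 htree.isAcyclic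
      (G.without_adj_src_tgt (Set.notMem_empty i))
    rw [SimpleGraph.isBridge_iff] at hb
    intro h
    refine hb (h.mono ?_)
    intro u v huv
    rw [SimpleGraph.deleteEdges_adj]
    refine ⟨G.without_anti (Set.empty_subset _) huv, ?_⟩
    intro he
    rw [Set.mem_singleton_iff] at he
    refine G.not_without_adj_src_tgt hpar (Set.mem_insert i S) ?_
    rw [← SimpleGraph.mem_edgeSet, ← he]
    exact huv
  -- A single deletion leaves a cycle connected; `k ∈ S` supplies the second cut.
  · obtain ⟨k, hk⟩ := hS hcyc
    obtain ⟨hpar, h3, ⟨φ⟩⟩ := hcyc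
    obtain ⟨n, rfl⟩ : ∃ N, n = N + 3 := ⟨n - 3, by omega⟩
    set H := (G.without (insert i S)).map φ.toEquiv.toEmbedding with hH
    have hHadj : ∀ u v, H.Adj (φ u) (φ v) ↔ (G.without (insert i S)).Adj u v := fun u v =>
      SimpleGraph.map_adj_apply (f := φ.toEquiv.toEmbedding)
    have hle : H ≤ SimpleGraph.cycleGraph (n + 3) := by
      intro x y hxy
      obtain ⟨u, rfl⟩ := φ.surjective x
      obtain ⟨v, rfl⟩ := φ.surjective y
      exact φ.map_adj_iff.2 (G.without_anti (Set.empty_subset _) ((hHadj u v).1 hxy))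
    have hedge : ∀ j : Fin m, ∃ a, s(φ (G.src j), φ (G.tgt j)) = s(a, a + 1) := by
      intro j
      have h : (SimpleGraph.cycleGraph (n + 3)).Adj (φ (G.src j)) (φ (G.tgt j)) :=
        φ.map_adj_iff.2 (G.without_adj_src_tgt (Set.notMem_empty j))
      rw [SimpleGraph.cycleGraph_adj] at h
      rcases h with h | h
      · exact ⟨φ (G.tgt j), by rw [Sym2.eq_swap, ← h, add_sub_cancel]⟩
      · exact ⟨φ (G.src j), by rw [← h, add_sub_cancel]⟩
    have hnadj : ∀ j ∈ insert i S, ∀ a, s(φ (G.src j), φ (G.tgt j)) = s(a, a + 1) →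
        ¬ H.Adj a (a + 1) := by
      intro j hj a ha
      rw [← SimpleGraph.mem_edgeSet, ← ha, SimpleGraph.mem_edgeSet, hHadj]
      exact G.not_without_adj_src_tgt hpar hj
    obtain ⟨a, ha⟩ := hedge i
    obtain ⟨b, hb⟩ := hedge k
    have hab : a ≠ b := by
      rintro rfl
      have hinj : s(G.src i, G.tgt i) = s(G.src k, G.tgt k) := by
        apply Sym2.map.injective φ.injective
        simpa using ha.trans hb.symm
      exact hi (hpar hinj ▸ hk)
    have hnr := SimpleGraph.not_reachable_of_le_cycleGraph H hle hab
      (hnadj i (Set.mem_insert _ _) a ha) (hnadj k (Set.mem_insert_of_mem _ hk) b hb)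
    intro hr
    have hr' : H.Reachable (φ (G.src i)) (φ (G.tgt i)) :=
      hr.map ⟨φ, fun {u v} h => (hHadj u v).2 h⟩
    rw [Sym2.eq_iff] at ha
    rcases ha with ⟨h1, h2⟩ | ⟨h1, h2⟩
    · rw [h1, h2] at hr'; exact hnr hr'
    · rw [h1, h2] at hr'; exact hnr hr'.symm

lemma card_le_nMax {S : Set (Fin m)} {s : Finset (Fin n)} {u : Fin n}
    (hs : ∀ v ∈ s, (G.without S).Reachable u v) : s.card ≤ G.nMax S := by
  have hfin : Finite (G.without S).ConnectedComponent := Quot.finite _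
  refine le_trans ?_ (le_ciSup (Set.finite_range _).bddAbove
    ((G.without S).connectedComponentMk u))
  rw [← Set.ncard_coe_finset]
  refine Set.ncard_le_ncard ?_ (Set.toFinite _)
  intro v hv
  exact SimpleGraph.ConnectedComponent.sound (hs v hv).symm

/-- The columns of the pseudoinverse of `D_{-S}` and a bound on their lengths. -/
lemma exists_dual_vector (hG : G.IsTreeGraph ∨ G.IsCycleGraph) {S : Set (Fin m)}
    (hS : G.IsCycleGraph → S.Nonempty) {i : Fin m} (hi : i ∉ S) :
    ∃ d : Fin n → ℝ, (∀ k ∉ S, (G.incidence *ᵥ d) k = if k = i then 1 else 0) ∧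
      (∀ v : Fin n → ℝ, (∀ k ∉ S, (G.incidence *ᵥ v) k = 0) → ∑ j, d j * v j = 0) ∧
      4 * ∑ j, d j ^ 2 ≤ G.nMax S := by
  classical
  have hbridge := G.not_reachable_without_insert hG hS hi
  set H := G.without (insert i S) with hH
  have hHS : H ≤ G.without S := G.without_anti (Set.subset_insert _ _)
  set T := Finset.univ.filter fun v => H.Reachable (G.tgt i) v with hT
  set U := Finset.univ.filter fun v => H.Reachable (G.src i) v with hU
  have hmT : ∀ v, v ∈ T ↔ H.Reachable (G.tgt i) v := by simp [hT]
  have hmU : ∀ v, v ∈ U ↔ H.Reachable (G.src i) v := by simp [hU]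
  have hdisj : Disjoint U T := by
    rw [Finset.disjoint_left]
    intro v hv hv'
    exact hbridge (((hmU v).1 hv).trans ((hmT v).1 hv').symm)
  have htT : G.tgt i ∈ T := (hmT _).2 (SimpleGraph.Reachable.refl _)
  have hsU : G.src i ∈ U := (hmU _).2 (SimpleGraph.Reachable.refl _)
  have hsT : G.src i ∉ T := Finset.disjoint_left.1 hdisj hsU
  have htU : G.tgt i ∉ U := Finset.disjoint_right.1 hdisj htT
  set p : ℝ := (U.card : ℝ) with hp
  set q : ℝ := (T.card : ℝ) with hq
  have hp0 : 0 < p := Nat.cast_pos.2 (Finset.card_pos.2 ⟨_, hsU⟩)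
  have hq0 : 0 < q := Nat.cast_pos.2 (Finset.card_pos.2 ⟨_, htT⟩)
  -- The weights make `d` jump by `1` across edge `i` and sum to zero over `U ∪ T`. Nullspace
  -- vectors of `D_{-S}` are constant there, hence orthogonal to `d`.
  let d : Fin n → ℝ := fun v =>
    (if v ∈ T then p / (p + q) else 0) - (if v ∈ U then q / (p + q) else 0)
  have hsum : ∀ w : Fin n → ℝ, ∑ j, d j * w j
      = p / (p + q) * ∑ j ∈ T, w j - q / (p + q) * ∑ j ∈ U, w j := by
    intro w
    simp only [d, sub_mul, Finset.sum_sub_distrib, ite_mul, zero_mul, Finset.sum_ite_mem,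
      Finset.univ_inter, Finset.mul_sum]
  refine ⟨d, ?_, ?_, ?_⟩
  · intro k hk
    rw [incidence_mulVec]
    split_ifs with hki
    · subst hki
      simp only [d, htT, hsU, hsT, htU, if_true, if_false]
      field_simp
      ring
    · have hadj : H.Adj (G.src k) (G.tgt k) := G.without_adj_src_tgt (by
        rw [Set.mem_insert_iff, not_or]; exact ⟨hki, hk⟩)
      have h1 : G.tgt k ∈ T ↔ G.src k ∈ T := by
        rw [hmT, hmT]
        exact ⟨fun h => h.trans hadj.symm.reachable, fun h => h.trans hadj.reachable⟩
      have h2 : G.tgt k ∈ U ↔ G.src k ∈ U := by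
        rw [hmU, hmU]
        exact ⟨fun h => h.trans hadj.symm.reachable, fun h => h.trans hadj.reachable⟩
      simp only [d, h1, h2, sub_self]
  · intro v hv
    have hconst : ∀ x, (G.without S).Reachable (G.src i) x → v x = v (G.src i) := by
      intro x hx
      refine hx.mem_of_forall_adj (p := fun x => v x = v (G.src i)) ?_ rfl
      intro x y hxy h
      obtain ⟨k, hk, e⟩ := G.without_adj.1 hxy
      have h0 := hv k hk
      rw [incidence_mulVec] at h0
      rw [Sym2.eq_iff] at e
      rcases e with ⟨rfl, rfl⟩ | ⟨rfl, rfl⟩ <;> linarith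
    have hst := (G.without_adj_src_tgt hi).reachable
    rw [hsum, Finset.sum_congr rfl fun x hx => hconst x (hst.trans (((hmT x).1 hx).mono hHS)),
      Finset.sum_congr rfl fun x hx => hconst x (((hmU x).1 hx).mono hHS)]
    simp only [Finset.sum_const, nsmul_eq_mul, ← hp, ← hq]
    ring
  · have hcard : p + q ≤ G.nMax S := by
      have := G.card_le_nMax (S := S) (s := U ∪ T) (u := G.src i) (by
        intro v hv
        rw [Finset.mem_union, hmU, hmT] at hv
        rcases hv with hv | hv
        · exact hv.mono hHS
        · exact (G.without_adj_src_tgt hi).reachable.trans (hv.mono hHS))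
      rw [Finset.card_union_of_disjoint hdisj] at this
      rw [hp, hq]
      exact_mod_cast this
    have h1 : ∑ j, d j ^ 2 = p * q / (p + q) := by
      simp_rw [pow_two]
      rw [hsum, Finset.sum_congr rfl fun x hx => (show d x = p / (p + q) by
          simp only [d, hx, Finset.disjoint_right.1 hdisj hx, if_true, if_false, sub_zero]),
        Finset.sum_congr (s₁ := U) rfl fun x hx => (show d x = -(q / (p + q)) by
          simp only [d, hx, Finset.disjoint_left.1 hdisj hx, if_true, if_false, zero_sub])]
      simp only [Finset.sum_const, nsmul_eq_mul, ← hp, ← hq]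
      field_simp
      ring
    refine le_trans ?_ hcard
    rw [h1, ← mul_div_assoc, div_le_iff₀ (by positivity)]
    nlinarith [sq_nonneg (p - q)]

end DirGraph

/-! ### From noise bounds to the oracle inequality. -/

section AnalysisEstimator

variable {m n : ℕ}

/-- The seminorm `g ↦ ∑_{i ∈ s} |(D g)_i|` on Euclidean space. -/
def analysisSeminorm (D : Matrix (Fin m) (Fin n) ℝ) (s : Finset (Fin m)) :
    Seminorm ℝ (EuclideanSpace ℝ (Fin n)) :=
  Seminorm.of (fun g => ∑ i ∈ s, |(D *ᵥ g.ofLp) i|)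
    (fun g h => by
      rw [← Finset.sum_add_distrib]
      refine Finset.sum_le_sum fun i _ => ?_
      rw [WithLp.ofLp_add, Matrix.mulVec_add]
      exact abs_add_le _ _)
    (fun c g => by
      rw [Finset.mul_sum]
      refine Finset.sum_congr rfl fun i _ => ?_
      rw [WithLp.ofLp_smul, Matrix.mulVec_smul, Pi.smul_apply, smul_eq_mul, abs_mul,
        Real.norm_eq_abs])

lemma analysisSeminorm_apply (D : Matrix (Fin m) (Fin n) ℝ) (s : Finset (Fin m))
    (g : EuclideanSpace ℝ (Fin n)) :
    analysisSeminorm D s g = ∑ i ∈ s, |(D *ᵥ g.ofLp) i| := rfl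

lemma analysisSeminorm_le (D : Matrix (Fin m) (Fin n) ℝ) (s : Finset (Fin m))
    (g : EuclideanSpace ℝ (Fin n)) : analysisSeminorm D s g ≤ l1Norm (D *ᵥ g.ofLp) :=
  Finset.sum_le_univ_sum_of_nonneg fun _ => abs_nonneg _

/-- The nullspace of `D_{-S}` as a subspace of Euclidean space. -/
def euclideanNullspace (D : Matrix (Fin m) (Fin n) ℝ) (S : Set (Fin m)) :
    Submodule ℝ (EuclideanSpace ℝ (Fin n)) :=
  (LinearMap.ker (rowsOff D S).mulVecLin).map (WithLp.linearEquiv 2 ℝ (Fin n → ℝ)).symm.toLinearMap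

lemma finrank_euclideanNullspace (D : Matrix (Fin m) (Fin n) ℝ) (S : Set (Fin m)) :
    Module.finrank ℝ (euclideanNullspace D S) = nullDim D S :=
  LinearEquiv.finrank_map_eq _ _

lemma mem_euclideanNullspace {D : Matrix (Fin m) (Fin n) ℝ} {S : Set (Fin m)}
    {v : EuclideanSpace ℝ (Fin n)} :
    v ∈ euclideanNullspace D S ↔ ∀ k ∉ S, (D *ᵥ v.ofLp) k = 0 := by
  rw [euclideanNullspace, Submodule.mem_map_equiv, LinearMap.mem_ker, LinearEquiv.symm_symm,
    funext_iff]
  exact ⟨fun h k hk => h ⟨k, hk⟩, fun h k => h k.1 k.2⟩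

lemma empNorm_eq (f : Fin n → ℝ) : empNorm f = ‖WithLp.toLp 2 f‖ / √n := by
  rw [empNorm, Real.sqrt_div (by positivity), EuclideanSpace.norm_eq]
  simp [sq_abs]

/-- Dual vectors are linearly independent. This caps the number of terms in the union bound. -/
lemma card_le_of_dual_vectors {D : Matrix (Fin m) (Fin n) ℝ} {s : Finset (Fin m)}
    {d : Fin m → EuclideanSpace ℝ (Fin n)}
    (hd : ∀ i ∈ s, ∀ k ∈ s, (D *ᵥ (d i).ofLp) k = if k = i then 1 else 0) : s.card ≤ n := by
  have hli : LinearIndependent ℝ fun i : s => d i := by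
    rw [Fintype.linearIndependent_iff]
    intro c hc k
    have h := congrArg (fun v : EuclideanSpace ℝ (Fin n) => (D *ᵥ v.ofLp) k) hc
    simp only [WithLp.ofLp_sum, WithLp.ofLp_smul, WithLp.ofLp_zero, Matrix.mulVec_zero,
      Matrix.mulVec_sum, Matrix.mulVec_smul, Finset.sum_apply, Pi.smul_apply, smul_eq_mul,
      Pi.zero_apply] at h
    rw [Finset.sum_congr rfl fun i _ => by rw [hd i i.2 k k.2]] at h
    simpa [Subtype.coe_inj] using h
  have := hli.fintype_card_le_finrank
  simpa using this

/-- The bound on the noise by its projection on the nullspace of `D_{-S}` and its inner products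
with the columns of the pseudoinverse of `D_{-S}`. -/
lemma inner_le_of_dual_vectors {D : Matrix (Fin m) (Fin n) ℝ} {S : Set (Fin m)}
    {s : Finset (Fin m)} (hs : ∀ i, i ∈ s ↔ i ∉ S) {d : Fin m → EuclideanSpace ℝ (Fin n)}
    (hd : ∀ i ∈ s, ∀ k ∈ s, (D *ᵥ (d i).ofLp) k = if k = i then 1 else 0)
    (horth : ∀ i ∈ s, ∀ v ∈ euclideanNullspace D S, inner ℝ (d i) v = 0)
    {e : EuclideanSpace ℝ (Fin n)} {B : ℝ} (hB : ∀ i ∈ s, |inner ℝ (d i) e| ≤ B)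
    (h : EuclideanSpace ℝ (Fin n)) :
    inner ℝ e h ≤ ‖(euclideanNullspace D S).orthogonalProjectionOnto e‖ * ‖h‖
      + B * analysisSeminorm D s h := by
  set N := euclideanNullspace D S
  -- By duality `w` has the same differences as `h` off `S`, so `h - w` is the nullspace component
  -- of `h`.
  set w := ∑ i ∈ s, (D *ᵥ h.ofLp) i • d i with hw
  have hwN : h - w ∈ N := by
    rw [mem_euclideanNullspace]
    intro k hk
    have hk' := (hs k).2 hk
    simp only [hw, WithLp.ofLp_sub, WithLp.ofLp_sum, WithLp.ofLp_smul, Matrix.mulVec_sub,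
      Matrix.mulVec_sum, Matrix.mulVec_smul, Finset.sum_apply, Pi.smul_apply, smul_eq_mul,
      Pi.sub_apply]
    rw [Finset.sum_congr rfl fun i hi => by rw [hd i hi k hk']]
    simp [hk']
  have hwo : ∀ v ∈ N, inner ℝ v w = 0 := by
    intro v hv
    rw [hw, inner_sum]
    refine Finset.sum_eq_zero fun i hi => ?_
    rw [real_inner_smul_right, real_inner_comm, horth i hi v hv, mul_zero]
  set z : EuclideanSpace ℝ (Fin n) := (N.orthogonalProjectionOnto e : EuclideanSpace ℝ (Fin n))
  have h1 : inner ℝ e (h - w) = inner ℝ z h := by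
    have : inner ℝ e (h - w) = inner ℝ z (h - w) :=
      (N.inner_orthogonalProjectionOnto_eq_of_mem_right ⟨h - w, hwN⟩ e).symm
    rw [this, inner_sub_right, hwo z (Subtype.coe_prop _), sub_zero]
  have h2 : inner ℝ e w ≤ B * analysisSeminorm D s h := by
    rw [hw, inner_sum, analysisSeminorm_apply, Finset.mul_sum]
    refine Finset.sum_le_sum fun i hi => ?_
    rw [real_inner_smul_right, real_inner_comm]
    calc (D *ᵥ h.ofLp) i * inner ℝ (d i) e
        ≤ |(D *ᵥ h.ofLp) i| * |inner ℝ (d i) e| := by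
          rw [← abs_mul]; exact le_abs_self _
      _ ≤ |(D *ᵥ h.ofLp) i| * B := by gcongr; exact hB i hi
      _ = B * |(D *ᵥ h.ofLp) i| := mul_comm _ _
  have h3 : inner ℝ z h ≤ ‖z‖ * ‖h‖ := real_inner_le_norm z h
  have h4 : inner ℝ e h = inner ℝ e (h - w) + inner ℝ e w := by
    rw [← inner_add_right, sub_add_cancel]
  rw [h4, h1]
  exact add_le_add h3 h2

lemma sub_sqrt_eq {n a : ℝ} (hn : 0 < n) :
    n - √(8 * a * n) = n * (1 - √(8 * a / n)) := by
  have : √(8 * a * n) = n * √(8 * a / n) := by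
    rw [show 8 * a * n = n ^ 2 * (8 * a / n) by field_simp, Real.sqrt_mul (by positivity),
      Real.sqrt_sq hn.le]
  rw [this]; ring

/-- The oracle inequality of the square root analysis estimator under bounds on the noise. -/
lemma empNorm_sq_le_of_noise_bounds {D : Matrix (Fin m) (Fin n) ℝ} {S : Set (Fin m)}
    {f0 : Fin n → ℝ} {σ lam0 a η : ℝ} (hσ : 0 < σ) (hA : SqrtAssumption D S f0 σ lam0 a η)
    (s : Finset (Fin m)) {e : EuclideanSpace ℝ (Fin n)}
    (hproj : ‖(euclideanNullspace D S).orthogonalProjectionOnto e‖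
      ≤ σ * (√(nullDim D S) + √(2 * a)))
    (hlow : σ * √(n - √(8 * a * n)) ≤ ‖e‖) (hup : ‖e‖ ≤ σ * (√n + √(2 * a)))
    (hinner : ∀ h, inner ℝ e h ≤ ‖(euclideanNullspace D S).orthogonalProjectionOnto e‖ * ‖h‖
      + (1 - η) * ‖e‖ * (√n * lam0) * analysisSeminorm D s h)
    {fhat : Fin n → ℝ} (hmin : IsSqrtAnalysisEstimator D lam0 (f0 + e.ofLp) fhat)
    (f : Fin n → ℝ) :
    empNorm (fhat - f0) ^ 2 ≤ empNorm (f - f0) ^ 2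
      + σ ^ 2 / n * (√(2 * a) + √(nullDim D S)) ^ 2 + 16 * σ * lam0 * l1Norm (D *ᵥ f) := by
  obtain ⟨ha, hn8, ⟨hη0, hη1⟩, ⟨R, hR, hRlam⟩, hsig, hηl⟩ := hA
  have hn : (0 : ℝ) < n := by linarith
  have hlam : 0 < lam0 := lt_of_lt_of_le (by have : 0 < 1 - η := by linarith
                                             positivity) hRlam
  have hsn : 0 < √(n : ℝ) := Real.sqrt_pos.2 hn
  have hsn2 : √(n : ℝ) ^ 2 = n := Real.sq_sqrt hn.le
  set W := ‖(euclideanNullspace D S).orthogonalProjectionOnto e‖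
  set r := √(nullDim D S : ℝ)
  set L := √(n - √(8 * a * n)) with hL
  have hLpos : 0 < L := by
    rw [hL, sub_sqrt_eq hn]
    refine Real.sqrt_pos.2 (mul_pos hn ?_)
    have : √(8 * a / n) < 1 := by
      rw [Real.sqrt_lt' one_pos, one_pow, div_lt_one hn]; exact hn8
    linarith
  set ρ := (r + √(2 * a)) / L with hρ
  have hρ0 : 0 ≤ ρ := by positivity
  have he : 0 < ‖e‖ := lt_of_lt_of_le (by positivity) hlow
  set c := overfitConst n (nullDim D S) a η with hc
  have hcsq : (c + 2) ^ 2 = (η / 2 - ρ) ^ 2 + 4 := by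
    rw [hc, overfitConst, sub_add_cancel, Real.sq_sqrt (by positivity)]
  have hc2 : 0 ≤ c + 2 := by rw [hc, overfitConst, sub_add_cancel]; positivity
  have hc0 : 0 ≤ c := by nlinarith [sq_nonneg (η / 2 - ρ)]
  have hc1 : c ≤ 1 := by nlinarith
  set κ : NNReal := ⟨√n * lam0, by positivity⟩ with hκ
  set q := κ • analysisSeminorm D Finset.univ with hq
  set q' := κ • analysisSeminorm D s with hq'
  have hqa : ∀ g, q g = √n * lam0 * l1Norm (D *ᵥ g.ofLp) := fun g => rfl
  have hqa' : ∀ g, q' g = √n * lam0 * analysisSeminorm D s g := fun g => rfl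
  have hqq : ∀ g, q' g ≤ q g := fun g => by
    rw [hqa, hqa']
    gcongr
    exact analysisSeminorm_le D s g
  have hmin' : ∀ g, ‖WithLp.toLp 2 f0 + e - WithLp.toLp 2 fhat‖ + q (WithLp.toLp 2 fhat)
      ≤ ‖WithLp.toLp 2 f0 + e - g‖ + q g := by
    intro g
    have h := hmin (Set.mem_univ g.ofLp)
    simp only [Set.mem_ofPred_eq, empNorm_eq] at h
    have h2 := mul_le_mul_of_nonneg_left h hsn.le
    rw [mul_add, mul_add, mul_div_cancel₀ _ hsn.ne', mul_div_cancel₀ _ hsn.ne', ← mul_assoc,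
      ← mul_assoc] at h2
    exact h2
  have hin : ∀ h, inner ℝ e h ≤ W * ‖h‖ + (1 - η) * ‖e‖ * q' h := by
    intro h
    rw [hqa', ← mul_assoc]
    exact hinner h
  have hWρ : W ≤ ρ * ‖e‖ := by
    calc W ≤ σ * (r + √(2 * a)) := hproj
      _ = ρ * (σ * L) := by rw [hρ]; field_simp
      _ ≤ ρ * ‖e‖ := by gcongr
  have hf0 : q (WithLp.toLp 2 f0) ≤ c * ‖e‖ := by
    rw [hqa]
    calc √n * lam0 * l1Norm (D *ᵥ f0)
        ≤ √n * lam0 * (c * σ * √(1 - √(8 * a / n)) / lam0) := by gcongr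
      _ = c * (σ * (√n * √(1 - √(8 * a / n)))) := by field_simp
      _ = c * (σ * L) := by rw [← Real.sqrt_mul hn.le, ← sub_sqrt_eq hn]
      _ ≤ c * ‖e‖ := by gcongr
  have hres := norm_residual_ge_of_isMinOn q q' hqq hmin' hη0 hη1 he hρ0 hηl
    (fun h => (hin h).trans (by gcongr)) hcsq hf0
  have hresup := norm_residual_le_of_isMinOn q hmin'
  have hmain := norm_sub_sq_le_of_isMinOn q q' hqq hmin' hin hres (WithLp.toLp 2 f)
  have h2a : √(2 * a) ≤ √n / 2 := by
    rw [Real.sqrt_le_left (by positivity), div_pow, hsn2]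
    linarith
  -- As `8a < n`, `‖e‖ ≤ (3/2)σ√n`; with `c ≤ 1` the residual is at most `3σ√n`. The slack bound `4`
  -- times the `4` of the oracle inequality gives `16`.
  have hres16 : ‖WithLp.toLp 2 f0 + e - WithLp.toLp 2 fhat‖ ≤ 4 * (σ * √n) := by
    have h1 : ‖e‖ ≤ σ * (√n + √n / 2) := hup.trans (by gcongr)
    have h2 : c * ‖e‖ ≤ 1 * ‖e‖ := by gcongr
    have h3 : 0 < σ * √n := by positivity
    linarith
  rw [empNorm_eq, empNorm_eq, div_pow, div_pow, hsn2]
  rw [hqa] at hmain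
  have hl1 : 0 ≤ l1Norm (D *ᵥ f) := Finset.sum_nonneg fun _ _ => abs_nonneg _
  have hfin : ‖WithLp.toLp 2 (fhat - f0)‖ ^ 2 ≤ ‖WithLp.toLp 2 (f - f0)‖ ^ 2
      + σ ^ 2 * (√(2 * a) + r) ^ 2 + n * (16 * σ * lam0 * l1Norm (D *ᵥ f)) := by
    refine hmain.trans ?_
    have h1 : W ^ 2 ≤ σ ^ 2 * (√(2 * a) + r) ^ 2 := by
      rw [← mul_pow, add_comm (√(2 * a))]
      gcongr
    have h2 : 4 * ‖WithLp.toLp 2 f0 + e - WithLp.toLp 2 fhat‖ * (√n * lam0 * l1Norm (D *ᵥ f))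
        ≤ 4 * (4 * (σ * √n)) * (√n * lam0 * l1Norm (D *ᵥ f)) := by gcongr
    have h3 : 4 * (4 * (σ * √n)) * (√n * lam0 * l1Norm (D *ᵥ f))
        = n * (16 * σ * lam0 * l1Norm (D *ᵥ f)) := by
      calc _ = √n ^ 2 * (16 * σ * lam0 * l1Norm (D *ᵥ f)) := by ring
        _ = _ := by rw [hsn2]
    exact add_le_add (add_le_add le_rfl h1) (h2.trans h3.le)
  calc ‖WithLp.toLp 2 (fhat - f0)‖ ^ 2 / n
      ≤ (‖WithLp.toLp 2 (f - f0)‖ ^ 2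
      + σ ^ 2 * (√(2 * a) + r) ^ 2 + n * (16 * σ * lam0 * l1Norm (D *ᵥ f))) / n := by gcongr
    _ = _ := by field_simp

end AnalysisEstimator

/-! ### Standardized noise and the probability of the good event. -/

lemma hasLaw_stdGaussian_of_pi_gaussianReal {n : ℕ} {Ω : Type*} [MeasurableSpace Ω] {P : Measure Ω}
    {σ : ℝ} (hσ : 0 < σ) {ε : Ω → Fin n → ℝ}
    (hε : HasLaw ε (Measure.pi fun _ : Fin n => gaussianReal 0 (Real.toNNReal (σ ^ 2))) P) :
    HasLaw (fun ω => WithLp.toLp 2 (σ⁻¹ • ε ω)) (stdGaussian (EuclideanSpace ℝ (Fin n))) P := by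
  have h : HasLaw (fun x : Fin n → ℝ => WithLp.toLp 2 (σ⁻¹ • x))
      (stdGaussian (EuclideanSpace ℝ (Fin n)))
      (Measure.pi fun _ : Fin n => gaussianReal 0 (Real.toNNReal (σ ^ 2))) := by
    refine ⟨by fun_prop, ?_⟩
    have h1 : (Measure.pi fun _ : Fin n => gaussianReal 0 (Real.toNNReal (σ ^ 2))).map
        (fun x i => σ⁻¹ * x i) = Measure.pi fun _ : Fin n => gaussianReal 0 1 := by
      have : ∀ i : Fin n, SigmaFinite ((gaussianReal 0 (Real.toNNReal (σ ^ 2))).map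
          (fun x => σ⁻¹ * x)) := fun _ => by
        rw [gaussianReal_map_const_mul]; infer_instance
      rw [Measure.pi_map_pi (f := fun _ x => σ⁻¹ * x) fun i => by fun_prop]
      congr 1
      ext1 i
      rw [gaussianReal_map_const_mul, mul_zero]
      congr 1
      ext
      simp only [NNReal.coe_mul, NNReal.coe_mk, Real.coe_toNNReal _ (sq_nonneg σ), NNReal.coe_one]
      field_simp
    rw [← map_pi_eq_stdGaussian, ← h1, Measure.map_map (by fun_prop) (by fun_prop)]
    rfl
  exact h.comp hε

theorem corollary4p10 {n m : ℕ} (G : DirGraph n m) (hG : G.IsTreeGraph ∨ G.IsCycleGraph)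
    (S : Set (Fin m)) (hS : S ∈ admissibleSets G.incidence)
    (hScycle : G.IsCycleGraph → S.Nonempty)
    {Ω : Type*} [MeasurableSpace Ω] (P : Measure Ω) [IsProbabilityMeasure P]
    (f0 : Fin n → ℝ) (σ : ℝ) (hσ : 0 < σ) (ε : Ω → Fin n → ℝ)
    (hε : HasLaw ε (Measure.pi fun _ : Fin n => gaussianReal 0 (Real.toNNReal (σ ^ 2))) P)
    (a η t lam0 : ℝ)
    (hassume : SqrtAssumption G.incidence S f0 σ lam0 a η)
    (ht0 : 0 < t)
    (ht : t < ((n : ℝ) - 1) / 2 - Real.log (2 * ((n : ℝ) - nullDim G.incidence S)))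
    (hlam0 : 1 / (1 - η) * √(G.nMax S * ((Real.log (2 * n) + t) / (n * ((n : ℝ) - 1)))) ≤ lam0)
    (f : Fin n → ℝ) :
    1 - Real.exp (-t) - 4 * Real.exp (-a) ≤
      P.real {ω | ∀ fhat : Fin n → ℝ,
        IsSqrtAnalysisEstimator G.incidence lam0 (f0 + ε ω) fhat →
        empNorm (fhat - f0) ^ 2 ≤
          empNorm (f - f0) ^ 2
            + σ ^ 2 / n * (√(2 * a) + √(nullDim G.incidence S)) ^ 2
            + 16 * σ * lam0 * l1Norm (G.incidence *ᵥ f)} := by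
  classical
  have ha := hassume.a_pos
  have hn8 := hassume.n_large
  have hη1 : 0 < 1 - η := sub_pos.2 hassume.η_mem.2
  have hn : (0 : ℝ) < n := by linarith
  have hn1 : (1 : ℝ) ≤ n := by exact_mod_cast Nat.cast_pos.1 hn
  choose! d hd horth hdn using fun i (hi : i ∉ S) => G.exists_dual_vector hG hScycle hi
  set D := G.incidence
  set s := Finset.univ.filter fun i => i ∉ S with hsdef
  have hs : ∀ i, i ∈ s ↔ i ∉ S := by simp [hsdef]
  set A := Real.log (2 * n) + t with hA
  have hA0 : 0 ≤ A := add_nonneg (Real.log_nonneg (by linarith)) ht0.le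
  set v : Fin m → EuclideanSpace ℝ (Fin n) := fun i => WithLp.toLp 2 (d i) with hv
  have hvdual : ∀ i ∈ s, ∀ k ∈ s, (D *ᵥ (v i).ofLp) k = if k = i then 1 else 0 :=
    fun i hi k hk => hd i ((hs i).1 hi) k ((hs k).1 hk)
  have hvorth : ∀ i ∈ s, ∀ w ∈ euclideanNullspace D S, inner ℝ (v i) w = 0 := by
    intro i hi w hw
    have := horth i ((hs i).1 hi) w.ofLp (mem_euclideanNullspace.1 hw)
    rw [← this, PiLp.inner_apply]
    exact Finset.sum_congr rfl fun j _ => by simp [hv, mul_comm]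
  have hvn : ∀ i ∈ s, 4 * ‖v i‖ ^ 2 ≤ G.nMax S := by
    intro i hi
    rw [EuclideanSpace.norm_sq_eq]
    simpa [hv, sq_abs] using hdn i ((hs i).1 hi)
  set N := euclideanNullspace D S with hN
  set μ := stdGaussian (EuclideanSpace ℝ (Fin n)) with hμ
  set K : ℝ := G.nMax S * A / (n - 1) with hK
  let B1 : Set (EuclideanSpace ℝ (Fin n)) :=
    {x | √(nullDim D S) + √(2 * a) < ‖N.orthogonalProjectionOnto x‖}
  let B2 : Set (EuclideanSpace ℝ (Fin n)) := {x | ‖x‖ ^ 2 < n - √(8 * a * n)}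
  let B3 : Set (EuclideanSpace ℝ (Fin n)) := {x | √n + √(2 * a) < ‖x‖}
  let B4 : Fin m → Set (EuclideanSpace ℝ (Fin n)) := fun i =>
    {x | K * ‖x‖ ^ 2 < inner ℝ (v i) x ^ 2}
  have hfr : (Module.finrank ℝ (EuclideanSpace ℝ (Fin n)) : ℝ) = n := by simp
  have hB1 : μ.real B1 ≤ Real.exp (-a) := by
    have h := stdGaussian_real_norm_orthogonalProjection_gt_le N ha
    rwa [hN, finrank_euclideanNullspace] at h
  have hB2 : μ.real B2 ≤ Real.exp (-a) := by
    have h := stdGaussian_real_norm_sq_lt_le (E := EuclideanSpace ℝ (Fin n)) ha (by rwa [hfr])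
    rwa [hfr] at h
  have hB3 : μ.real B3 ≤ Real.exp (-a) := by
    have h := stdGaussian_real_norm_gt_le (E := EuclideanSpace ℝ (Fin n)) ha
    rwa [hfr] at h
  -- `A = log (2n) + t` is chosen so that `2e^(-A) = e^(-t)/n`. The existence of an edge forces `n ≥
  -- 2`.
  have hB4 : ∀ i ∈ s, μ.real (B4 i) ≤ Real.exp (-t) / n := by
    intro i hi
    have hn2 : 1 < Module.finrank ℝ (EuclideanSpace ℝ (Fin n)) := by
      rw [finrank_euclideanSpace]
      exact Fintype.one_lt_card_iff.2 ⟨_, _, G.src_ne_tgt i⟩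
    have h := stdGaussian_real_inner_sq_gt_le (v i) hA0 hn2 (hvn i hi)
    rw [hfr] at h
    refine h.trans (le_of_eq ?_)
    rw [hA, neg_add, Real.exp_add, Real.exp_neg, Real.exp_log (by positivity)]
    field_simp
  have hB4u : μ.real (⋃ i ∈ s, B4 i) ≤ Real.exp (-t) := by
    calc μ.real (⋃ i ∈ s, B4 i) ≤ ∑ i ∈ s, μ.real (B4 i) := measureReal_biUnion_finset_le _ _
      _ ≤ ∑ i ∈ s, Real.exp (-t) / n := Finset.sum_le_sum hB4
      _ = s.card * (Real.exp (-t) / n) := by rw [Finset.sum_const, nsmul_eq_mul]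
      _ ≤ n * (Real.exp (-t) / n) := by
        gcongr
        exact_mod_cast card_le_of_dual_vectors hvdual
      _ = Real.exp (-t) := by field_simp
  set bad := B1 ∪ B2 ∪ B3 ∪ ⋃ i ∈ s, B4 i with hbad
  have hbadm : MeasurableSet bad := by
    refine (((measurableSet_lt (by fun_prop) (by fun_prop)).union
      (measurableSet_lt (by fun_prop) (by fun_prop))).union
      (measurableSet_lt (by fun_prop) (by fun_prop))).union ?_
    exact Finset.measurableSet_biUnion _ fun i _ =>
      measurableSet_lt (by fun_prop) (by fun_prop)
  have hbadle : μ.real bad ≤ Real.exp (-t) + 3 * Real.exp (-a) := by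
    have h1 := measureReal_union_le (μ := μ) (B1 ∪ B2 ∪ B3) (⋃ i ∈ s, B4 i)
    have h2 := measureReal_union_le (μ := μ) (B1 ∪ B2) B3
    have h3 := measureReal_union_le (μ := μ) B1 B2
    linarith
  have hX := hasLaw_stdGaussian_of_pi_gaussianReal hσ hε
  set X : Ω → EuclideanSpace ℝ (Fin n) := fun ω => WithLp.toLp 2 (σ⁻¹ • ε ω) with hXdef
  have hgood : 1 - Real.exp (-t) - 4 * Real.exp (-a) ≤ P.real (X ⁻¹' badᶜ) := by
    have h1 : P.real (X ⁻¹' badᶜ) = μ.real badᶜ := by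
      rw [hμ, ← hX.map_eq, measureReal_def, measureReal_def,
        Measure.map_apply_of_aemeasurable hX.aemeasurable hbadm.compl]
    rw [h1, probReal_compl_eq_one_sub hbadm]
    have := Real.exp_pos (-a)
    linarith
  -- Monotonicity of the measure suffices, so the event about all minimizers need not be shown
  -- measurable.
  refine hgood.trans (measureReal_mono ?_)
  intro ω hω fhat hfhat
  have hω' : X ω ∉ bad := hω
  simp only [hbad, Set.mem_union, Set.mem_iUnion, not_or, not_exists] at hω'
  obtain ⟨⟨⟨h1, h2⟩, h3⟩, h4⟩ := hω'
  replace h1 : ‖N.orthogonalProjectionOnto (X ω)‖ ≤ √(nullDim D S) + √(2 * a) := not_lt.1 h1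
  replace h2 : n - √(8 * a * n) ≤ ‖X ω‖ ^ 2 := not_lt.1 h2
  replace h3 : ‖X ω‖ ≤ √n + √(2 * a) := not_lt.1 h3
  replace h4 : ∀ i ∈ s, inner ℝ (v i) (X ω) ^ 2 ≤ K * ‖X ω‖ ^ 2 := fun i hi => not_lt.1 (h4 i hi)
  have he : ε ω = (σ • X ω).ofLp := by
    rw [hXdef, WithLp.ofLp_smul, smul_inv_smul₀ hσ.ne']
  have hnorm : ‖σ • X ω‖ = σ * ‖X ω‖ := by rw [norm_smul, Real.norm_of_nonneg hσ.le]
  have hproj : ‖N.orthogonalProjectionOnto (σ • X ω)‖ = σ * ‖N.orthogonalProjectionOnto (X ω)‖ := by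
    rw [map_smul, norm_smul, Real.norm_of_nonneg hσ.le]
  -- The lower bound on `lam0`, rescaled by `√n`, is exactly what lets the penalty absorb the ratios
  -- `|⟪v i, e⟫|/‖e‖`.
  have hlam : √K ≤ (1 - η) * (√n * lam0) := by
    have e1 : K = n * (G.nMax S * (A / (n * ((n : ℝ) - 1)))) := by
      rw [hK, ← mul_div_assoc, ← mul_div_assoc, mul_div_mul_left _ _ hn.ne']
    rw [e1, Real.sqrt_mul hn.le]
    rw [one_div, inv_mul_le_iff₀ hη1] at hlam0
    calc √n * √(G.nMax S * (A / (n * ((n : ℝ) - 1)))) ≤ √n * ((1 - η) * lam0) := by gcongr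
      _ = (1 - η) * (√n * lam0) := by ring
  rw [he] at hfhat
  refine empNorm_sq_le_of_noise_bounds hσ hassume s ?_ ?_ ?_ ?_ hfhat f
  · rw [hproj]
    gcongr
  · rw [hnorm]
    gcongr
    exact Real.sqrt_le_iff.2 ⟨norm_nonneg _, h2⟩
  · rw [hnorm]
    gcongr
  · refine inner_le_of_dual_vectors hs hvdual hvorth fun i hi => ?_
    rw [real_inner_smul_right, abs_mul, abs_of_pos hσ, hnorm]
    have hb : |inner ℝ (v i) (X ω)| ≤ √K * ‖X ω‖ := by
      rw [← Real.sqrt_sq (norm_nonneg (X ω)), ← Real.sqrt_mul' _ (sq_nonneg _)]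
      exact Real.abs_le_sqrt (h4 i hi)
    calc σ * |inner ℝ (v i) (X ω)| ≤ σ * ((1 - η) * (√n * lam0) * ‖X ω‖) := by
          gcongr
          exact hb.trans (by gcongr)
      _ = (1 - η) * (σ * ‖X ω‖) * (√n * lam0) := by ring
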